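/- Let $G$ be a simply connected nilpotent Lie group of real dimension $2n$, let $\Gamma\subset G$ be a discrete subgroup with $M=\Gamma\backslash G$ compact, and let $J$ be a left-invariant complex structure on $M$, i.e. one induced by an endomorphism $J$ of the Lie algebra $\mathfrak g$ of $G$ with $J^2=-1$ and $J[X,Y]-[JX,Y]-[X,JY]-J[JX,JY]=0$ for all $X,Y\in\mathfrak g$. (An object on $M$ is called left-invariant if it is induced by projection from a left-invariant object on $G$.) The Lee form of a Hermitian metric $g$ on $(M,J)$ with fundamental form $\omega(X,Y)=g(JX,Y)$ is the $1$-form $\theta$ with $d\omega^{n-1}=\theta\wedge\omega^{n-1}$, and $g$ is called locally conformally balanced (lcb) if $d\theta=0$. Let $g_1,g_2$ be two left-invariant lcb Hermitian metrics on $(M,J)$ with Lee forms $\theta_1\neq\theta_2$. Then $g_1$ and $g_2$ are not conformal, i.e. there is no smooth function $f:M\to\mathbb R$ with $g_2=e^{f}g_1$. Moreover $\theta_1-\theta_2$ is not exact, i.e. there is no smooth function $f:M\to\mathbb R$ with $\theta_1-\theta_2=df$. -/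

import Mathlib

open scoped Manifold ContDiff Topology

noncomputable section

/-! ### The quotient manifold `Γ \ G` -/

section Quotient

variable {G : Type*} [Group G]

/-- The quotient `Γ \ G`, i.e. the space of orbits of left multiplication by `Γ` on `G`. -/
def LeftQuotient (Γ : Subgroup G) : Type _ := MulAction.orbitRel.Quotient Γ G

/-- The projection `π : G → Γ \ G`. -/
def LeftQuotient.proj (Γ : Subgroup G) (p : G) : LeftQuotient Γ :=
  Quotient.mk (MulAction.orbitRel Γ G) p

theorem LeftQuotient.proj_surjective (Γ : Subgroup G) :
    Function.Surjective (LeftQuotient.proj Γ) := Quotient.mk_surjective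

theorem LeftQuotient.proj_eq_iff (Γ : Subgroup G) {p q : G} :
    LeftQuotient.proj Γ p = LeftQuotient.proj Γ q ↔ q * p⁻¹ ∈ Γ :=
  Quotient.eq''.trans QuotientGroup.rightRel_apply

variable [TopologicalSpace G]

/-- The quotient topology. -/
instance LeftQuotient.instTopologicalSpace (Γ : Subgroup G) :
    TopologicalSpace (LeftQuotient Γ) :=
  inferInstanceAs (TopologicalSpace (Quotient (MulAction.orbitRel Γ G)))

theorem LeftQuotient.isQuotientMap_proj (Γ : Subgroup G) :
    Topology.IsQuotientMap (LeftQuotient.proj Γ) := isQuotientMap_quotient_mk'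

theorem LeftQuotient.isLocalHomeomorph_proj [IsTopologicalGroup G] (Γ : Subgroup G)
    [DiscreteTopology Γ] : IsLocalHomeomorph (LeftQuotient.proj Γ) :=
  ((LeftQuotient.isQuotientMap_proj Γ).isQuotientCoveringMap_of_subgroup Γ
    ⟨inferInstanceAs (DiscreteTopology Γ)⟩
    (LeftQuotient.proj_eq_iff Γ)).isCoveringMap.isLocalHomeomorph

variable {E : Type*} [NormedAddCommGroup E] [NormedSpace ℝ E] [ChartedSpace E G]
  [LieGroup 𝓘(ℝ, E) ∞ G]

/-- The charts of `Γ \ G`: local inverses of the projection, followed by charts of `G`. -/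
instance LeftQuotient.instChartedSpace (Γ : Subgroup G) [DiscreteTopology Γ] :
    ChartedSpace E (LeftQuotient Γ) :=
  haveI : IsTopologicalGroup G := topologicalGroup_of_lieGroup 𝓘(ℝ, E) ∞
  (LeftQuotient.isLocalHomeomorph_proj Γ).chartedSpace (LeftQuotient.proj_surjective Γ)

instance LeftQuotient.instIsManifold (Γ : Subgroup G) [DiscreteTopology Γ] :
    IsManifold 𝓘(ℝ, E) ∞ (LeftQuotient Γ) := by
  have : IsTopologicalGroup G := topologicalGroup_of_lieGroup 𝓘(ℝ, E) ∞
  apply isManifold_of_contDiffOn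
  rintro _ _ ⟨q, rfl⟩ ⟨r, rfl⟩
  set h := LeftQuotient.isLocalHomeomorph_proj Γ
  set s := (LeftQuotient.proj_surjective Γ).hasRightInverse.choose
  set φ := h.localInverseAt (s q) with hφ
  set ψ := h.localInverseAt (s r) with hψ
  set a := chartAt E (s q)
  set b := chartAt E (s r)
  have hφs : ∀ p, φ.symm p = LeftQuotient.proj Γ p := fun p => by
    rw [hφ, IsLocalHomeomorph.localInverseAt_symm]
  have hψs : ∀ p, ψ.symm p = LeftQuotient.proj Γ p := fun p => by
    rw [hψ, IsLocalHomeomorph.localInverseAt_symm]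
  intro u hu
  simp only [modelWithCornersSelf_coe, modelWithCornersSelf_coe_symm, Set.preimage_id,
    Set.range_id, Set.inter_univ, OpenPartialHomeomorph.trans_source,
    OpenPartialHomeomorph.symm_source, OpenPartialHomeomorph.trans_target, Set.mem_inter_iff,
    Set.mem_preimage, OpenPartialHomeomorph.coe_trans_symm, Function.comp_apply, hφs] at hu
  obtain ⟨⟨hua, -⟩, hu2, hu3⟩ := hu
  set p := a.symm u
  -- the second chart reaches the same point through a translate of `p` by an element of `Γ`
  set γ : G := ψ (LeftQuotient.proj Γ p) * p⁻¹
  have hγ : γ ∈ Γ := by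
    rw [← LeftQuotient.proj_eq_iff, ← hψs (ψ _), ψ.left_inv hu2]
  have hγp : γ * p = ψ (LeftQuotient.proj Γ p) := inv_mul_cancel_right _ _
  have hca : ContinuousAt a.symm u := a.continuousAt_symm hua
  have hc : ContinuousAt (fun u' => γ * a.symm u') u := hca.const_mul γ
  have hmem : ∀ᶠ u' in 𝓝 u, γ * a.symm u' ∈ ψ.target := by
    apply hc.eventually (ψ.open_target.mem_nhds _)
    change γ * p ∈ _
    rw [hγp]
    exact ψ.map_source hu2
  have heq : ∀ᶠ u' in 𝓝 u, ψ (LeftQuotient.proj Γ (a.symm u')) = γ * a.symm u' := by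
    filter_upwards [hmem] with u' hu'
    have : LeftQuotient.proj Γ (a.symm u') = LeftQuotient.proj Γ (γ * a.symm u') := by
      rw [LeftQuotient.proj_eq_iff, mul_inv_cancel_right]
      exact hγ
    rw [this, ← hψs, ψ.right_inv hu']
  have hsm : ContMDiffAt 𝓘(ℝ, E) 𝓘(ℝ, E) ∞ (fun u' => b (γ * a.symm u')) u := by
    have h1 : ContMDiffAt 𝓘(ℝ, E) 𝓘(ℝ, E) ∞ a.symm u :=
      (contMDiffOn_chart_symm (I := 𝓘(ℝ, E)) (n := ∞) (x := s q)).contMDiffAt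
        (a.open_target.mem_nhds hua)
    have h2 : ContMDiffAt 𝓘(ℝ, E) 𝓘(ℝ, E) ∞ (fun p' : G => γ * p') p :=
      (contMDiff_mul_left (I := 𝓘(ℝ, E)) (n := ∞) (a := γ)).contMDiffAt
    have h3 : ContMDiffAt 𝓘(ℝ, E) 𝓘(ℝ, E) ∞ b (γ * p) := by
      apply (contMDiffOn_chart (I := 𝓘(ℝ, E)) (n := ∞) (x := s r)).contMDiffAt
      rw [hγp]
      exact b.open_source.mem_nhds hu3
    exact h3.comp u (h2.comp u h1)
  refine (hsm.contDiffAt.congr_of_eventuallyEq ?_).contDiffWithinAt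
  filter_upwards [heq] with u' hu'
  simp only [modelWithCornersSelf_coe, modelWithCornersSelf_coe_symm,
    OpenPartialHomeomorph.coe_trans, OpenPartialHomeomorph.coe_trans_symm, Function.comp_apply, id,
    hφs]
  exact congrArg b hu'

end Quotient

/-! ### Exterior algebra and differential forms -/

section Wedge

variable {V : Type*} [AddCommGroup V] [Module ℝ V] [TopologicalSpace V]

/-- The wedge product of alternating forms, with the normalization
`(α ∧ β)(v) = ∑ sign(σ) α(v_{σ(1)}, …, v_{σ(k)}) β(v_{σ(k+1)}, …, v_{σ(k+l)})`,
the sum being over all `(k, l)`-shuffles `σ`. -/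
def wedge {k l : ℕ} (α : V [⋀^Fin k]→L[ℝ] ℝ) (β : V [⋀^Fin l]→L[ℝ] ℝ) :
    V [⋀^Fin (k + l)]→L[ℝ] ℝ :=
  { ((LinearMap.mul' ℝ ℝ).compAlternatingMap
      (α.toAlternatingMap.domCoprod β.toAlternatingMap)).domDomCongr finSumFinEquiv with
    cont := by
      change Continuous fun v : Fin (k + l) → V => LinearMap.mul' ℝ ℝ
        ((α.toAlternatingMap.domCoprod β.toAlternatingMap) fun i => v (finSumFinEquiv i))
      simp only [AlternatingMap.domCoprod_apply, sum_apply, map_sum]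
      refine continuous_finsetSum _ fun σ _ => ?_
      induction σ using Quotient.inductionOn'
      simp only [AlternatingMap.domCoprod.summand_mk'', smul_apply,
        MultilinearMap.domDomCongr_apply, MultilinearMap.domCoprod_apply]
      have hs : ∀ (c : ℤˣ) (t : TensorProduct ℝ ℝ ℝ), LinearMap.mul' ℝ ℝ (c • t) =
          c • LinearMap.mul' ℝ ℝ t := fun c t => by
        rcases Int.units_eq_one_or c with rfl | rfl <;> simp
      simp only [hs]
      refine Continuous.const_smul (Continuous.mul (α.cont.comp ?_) (β.cont.comp ?_)) _ <;>
        fun_prop }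

/-- The powers `η ^ m = η ∧ … ∧ η` of a `2`-form. -/
def wedgePow (η : V [⋀^Fin 2]→L[ℝ] ℝ) : (m : ℕ) → V [⋀^Fin (2 * m)]→L[ℝ] ℝ
  | 0 => ContinuousAlternatingMap.constOfIsEmpty ℝ V (Fin 0) 1
  | m + 1 => wedge (wedgePow η m) η

end Wedge

section Forms

variable (E : Type*) [NormedAddCommGroup E] [NormedSpace ℝ E]
  (M : Type*) [TopologicalSpace M] [ChartedSpace E M]

/-- Real differential forms of degree `k` on `M` (smoothness is a separate predicate). -/
abbrev DiffForm (k : ℕ) : Type _ :=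
  ∀ x : M, TangentSpace 𝓘(ℝ, E) x [⋀^Fin k]→L[ℝ] ℝ

variable {E M}

namespace DiffForm

variable {k : ℕ}

/-- The expression of a form in the preferred chart at `x₀`, i.e. its pullback under the inverse
chart; it is meaningful on the target of the chart. -/
def inChart (α : DiffForm E M k) (x₀ : M) (y : E) : E [⋀^Fin k]→L[ℝ] ℝ :=
  (α ((extChartAt 𝓘(ℝ, E) x₀).symm y)).compContinuousLinearMap
    (mfderiv 𝓘(ℝ, E) 𝓘(ℝ, E) (extChartAt 𝓘(ℝ, E) x₀).symm y)

/-- A form is smooth if its expressions in the charts are. -/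
def IsSmooth (α : DiffForm E M k) : Prop :=
  ∀ x₀ : M, ContDiffOn ℝ ∞ (α.inChart x₀) (extChartAt 𝓘(ℝ, E) x₀).target

/-- The exterior derivative, computed at each point `x` in the preferred chart at `x`. -/
def extD (α : DiffForm E M k) : DiffForm E M (k + 1) := fun x =>
  (extDeriv (α.inChart x) (extChartAt 𝓘(ℝ, E) x x)).compContinuousLinearMap
    (mfderiv 𝓘(ℝ, E) 𝓘(ℝ, E) (extChartAt 𝓘(ℝ, E) x) x)

/-- A `1`-form is exact if it is the differential of a smooth function. -/
def IsExact (α : DiffForm E M 1) : Prop :=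
  ∃ f : M → ℝ, ContMDiff 𝓘(ℝ, E) 𝓘(ℝ, ℝ) ∞ f ∧
    ∀ (x : M) (v : TangentSpace 𝓘(ℝ, E) x), α x ![v] = mfderiv 𝓘(ℝ, E) 𝓘(ℝ, ℝ) f x v

end DiffForm

end Forms

/-! ### Hermitian metrics -/

section Hermitian

variable (E : Type*) [NormedAddCommGroup E] [NormedSpace ℝ E]
  (M : Type*) [TopologicalSpace M] [ChartedSpace E M] [IsManifold 𝓘(ℝ, E) ∞ M]

/-- A smooth field `J` of endomorphisms of the tangent spaces with `J² = -1`. -/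
structure AlmostComplexStructure where
  J (x : M) : TangentSpace 𝓘(ℝ, E) x →L[ℝ] TangentSpace 𝓘(ℝ, E) x
  sq (x : M) (v : TangentSpace 𝓘(ℝ, E) x) : J x (J x v) = -v
  contMDiff : ContMDiff 𝓘(ℝ, E) (𝓘(ℝ, E).prod 𝓘(ℝ, E →L[ℝ] E)) ∞
    (fun x => Bundle.TotalSpace.mk' (E →L[ℝ] E)
      (E := fun x : M => TangentSpace 𝓘(ℝ, E) x →L[ℝ] TangentSpace 𝓘(ℝ, E) x) x (J x))

variable {E M}

/-- A Hermitian metric on `(M, J)`: a smooth Riemannian metric for which `J` is orthogonal. -/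
structure HermitianMetric (J : AlmostComplexStructure E M) extends
    Bundle.ContMDiffRiemannianMetric 𝓘(ℝ, E) ∞ E
      (fun x : M => TangentSpace 𝓘(ℝ, E) x) where
  hermitian (x : M) (v w : TangentSpace 𝓘(ℝ, E) x) :
    inner x (J.J x v) (J.J x w) = inner x v w

namespace HermitianMetric

variable {J : AlmostComplexStructure E M}

/-- The fundamental form `ω(X, Y) = g(JX, Y)`. -/
def fundamentalForm (g : HermitianMetric J) : DiffForm E M 2 := fun x =>
  { toFun := fun v => g.inner x (J.J x (v 0)) (v 1)
    map_update_add' := by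
      intro _ m i v w
      fin_cases i <;> simp [Function.update]
    map_update_smul' := by
      intro _ m i c v
      fin_cases i <;> simp [Function.update]
    map_eq_zero_of_eq' := by
      intro v i j hv hij
      have key : ∀ u : TangentSpace 𝓘(ℝ, E) x, g.inner x (J.J x u) u = 0 := fun u => by
        have h1 := g.hermitian x (J.J x u) u
        rw [J.sq, g.symm, map_neg] at h1
        linarith
      fin_cases i <;> fin_cases j <;> simp_all
    cont := by
      let B : E →L[ℝ] E →L[ℝ] ℝ := g.inner x
      let A : E →L[ℝ] E := J.J x
      change Continuous fun v : Fin 2 → E => B (A (v 0)) (v 1)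
      fun_prop }

/-- For `dim_ℂ M = n`: `θ` is the Lee form of `g`, i.e. the smooth `1`-form characterized by
`d(ω ^ (n - 1)) = θ ∧ ω ^ (n - 1)`, where `ω` is the fundamental form of `g`. -/
def IsLeeForm (n : ℕ) (g : HermitianMetric J) (θ : DiffForm E M 1) : Prop :=
  θ.IsSmooth ∧
    ∀ (x : M) (v : Fin (2 * (n - 1) + 1) → TangentSpace 𝓘(ℝ, E) x),
      DiffForm.extD (fun y => wedgePow (g.fundamentalForm y) (n - 1)) x v =
        wedge (θ x) (wedgePow (g.fundamentalForm x) (n - 1))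
          (v ∘ Fin.cast (Nat.add_comm 1 (2 * (n - 1))))

/-- For `dim_ℂ M = n`: `g` is locally conformally balanced, i.e. its Lee form is closed. -/
def IsLCB (n : ℕ) (g : HermitianMetric J) : Prop :=
  ∃ θ : DiffForm E M 1, g.IsLeeForm n θ ∧ θ.extD = 0

/-- `g₁` and `g₂` are conformal: `g₂ = e ^ f g₁` for a smooth real function `f` on `M`. -/
def IsConformal (g₁ g₂ : HermitianMetric J) : Prop :=
  ∃ f : M → ℝ, ContMDiff 𝓘(ℝ, E) 𝓘(ℝ, ℝ) ∞ f ∧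
    ∀ (x : M) (v w : TangentSpace 𝓘(ℝ, E) x),
      g₂.inner x v w = Real.exp (f x) * g₁.inner x v w

end HermitianMetric

end Hermitian

/-! ### Left-invariant objects on `Γ \ G` -/

section Invariant

variable {E : Type*} [NormedAddCommGroup E] [NormedSpace ℝ E]
  {G : Type*} [Group G] [TopologicalSpace G] [ChartedSpace E G]

/-- A complex structure on the Lie algebra of `G`: an endomorphism `J` with `J² = -1` and
vanishing Nijenhuis tensor. -/
def IsLieAlgebraComplexStructure
    (J : GroupLieAlgebra 𝓘(ℝ, E) G →ₗ[ℝ] GroupLieAlgebra 𝓘(ℝ, E) G) : Prop :=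
  (∀ X, J (J X) = -X) ∧ ∀ X Y, J ⁅X, Y⁆ - ⁅J X, Y⁆ - ⁅X, J Y⁆ - J ⁅J X, J Y⁆ = 0

variable [LieGroup 𝓘(ℝ, E) ∞ G] (Γ : Subgroup G) [DiscreteTopology Γ]

/-- The image in `T_{π(p)} (Γ \ G)` of the value at `p` of the left-invariant vector field on `G`
given by the vector `v` of the Lie algebra. -/
def LeftQuotient.frame (p : G) (v : GroupLieAlgebra 𝓘(ℝ, E) G) :
    TangentSpace 𝓘(ℝ, E) (LeftQuotient.proj Γ p) :=
  mfderiv 𝓘(ℝ, E) 𝓘(ℝ, E) (LeftQuotient.proj Γ) p (mulInvariantVectorField v p)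

variable {Γ}

/-- `J` is induced, through left translations and projection to `Γ \ G`, by a complex structure on
the Lie algebra of `G`. -/
def AlmostComplexStructure.IsLeftInvariantComplex
    (J : AlmostComplexStructure E (LeftQuotient Γ)) : Prop :=
  ∃ J₀ : GroupLieAlgebra 𝓘(ℝ, E) G →ₗ[ℝ] GroupLieAlgebra 𝓘(ℝ, E) G,
    IsLieAlgebraComplexStructure J₀ ∧
    ∀ (p : G) (v : GroupLieAlgebra 𝓘(ℝ, E) G),
      J.J (LeftQuotient.proj Γ p) (LeftQuotient.frame Γ p v) = LeftQuotient.frame Γ p (J₀ v)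

/-- `g` is induced by a left-invariant metric on `G`: its pullback to `G` has constant values on
left-invariant vector fields. -/
def HermitianMetric.IsLeftInvariant {J : AlmostComplexStructure E (LeftQuotient Γ)}
    (g : HermitianMetric J) : Prop :=
  ∃ g₀ : GroupLieAlgebra 𝓘(ℝ, E) G → GroupLieAlgebra 𝓘(ℝ, E) G → ℝ,
    ∀ (p : G) (v w : GroupLieAlgebra 𝓘(ℝ, E) G),
      g.inner (LeftQuotient.proj Γ p) (LeftQuotient.frame Γ p v) (LeftQuotient.frame Γ p w) =
        g₀ v w

end Invariant

end

/-!
The proof only uses that left-invariant data are constant in the frame of left-invariant vector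
fields, and that a Hermitian metric determines its Lee form.

*Uniqueness of the Lee form.* On a Hermitian vector space of complex dimension `n` the map
`α ↦ α ∧ ω ^ (n - 1)` is injective on `1`-forms (`eq_zero_of_wedge_wedgePow_eq_zero`): complete a
vector `X` with `α(X) ≠ 0` to a unitary family `X, f₁, J f₁, …`; up to a nonzero constant,
`(α ∧ ω ^ (n - 1))(X, f₁, J f₁, …)` is a signed sum over permutations in which all nonzero terms are
equal to `α(X) ∏ |fᵢ|²`.

*Invariance of the Lee form.* A left-invariant metric on `Γ \ G` has a left-invariant fundamental
form, because `J` is left-invariant. The exterior derivative commutes with the left translations of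
`G` (`DiffForm.IsLeftInvariant.extD`) and with the pullback by `π : G → Γ \ G`
(`LeftQuotient.IsDistinguished.extD_pullbackProj`), so `d(ω ^ (n - 1))` is left-invariant, and by
uniqueness so is the Lee form (`HermitianMetric.IsLeeForm.comp_frameCLM_eq`).

*Conclusion.* If `θ₁ - θ₂ = df`, then `df` vanishes at a maximum of `f`, which exists since `Γ \ G`
is compact; an invariant form vanishing at a point is zero, so `θ₁ = θ₂`. If `g₂ = e ^ f g₁`, then
evaluating both metrics on an invariant vector field shows that `e ^ f` is constant; homothetic
metrics have the same Lee form (`HermitianMetric.IsLeeForm.eq_of_homothetic`), so again `θ₁ = θ₂`.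
-/

noncomputable section

/-! ### Wedge products as sums over permutations -/

section WedgeFormula

variable {V : Type*} [AddCommGroup V] [Module ℝ V] [TopologicalSpace V]

theorem ContinuousAlternatingMap.factorial_mul_apply {k : ℕ} (α : V [⋀^Fin k]→L[ℝ] ℝ)
    (v : Fin k → V) :
    (k.factorial : ℝ) * α v =
      ∑ σ : Equiv.Perm (Fin k), (Equiv.Perm.sign σ : ℤ) * α (v ∘ σ) := by
  have h (σ : Equiv.Perm (Fin k)) : ((Equiv.Perm.sign σ : ℤ) : ℝ) * α (v ∘ σ) = α v := by
    have h1 : α (v ∘ σ) = Equiv.Perm.sign σ • α v := α.toAlternatingMap.map_perm v σ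
    rw [h1, Units.smul_def, zsmul_eq_mul, ← mul_assoc, ← Int.cast_mul, ← Units.val_mul,
      Int.units_mul_self]
    simp
  simp [h, Fintype.card_perm]

/-- The wedge product of two forms which are, up to scalars, the antisymmetrizations of multilinear
maps `a` and `b` is, up to the product of the scalars, the antisymmetrization of `a ⊗ b`. -/
theorem wedge_apply_of_alternatization {k l : ℕ} {α : V [⋀^Fin k]→L[ℝ] ℝ}
    {β : V [⋀^Fin l]→L[ℝ] ℝ} {a : MultilinearMap ℝ (fun _ : Fin k => V) ℝ}
    {b : MultilinearMap ℝ (fun _ : Fin l => V) ℝ} {c d : ℝ}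
    (hα : ∀ v, c * α v = ∑ σ : Equiv.Perm (Fin k), (Equiv.Perm.sign σ : ℤ) * a (v ∘ σ))
    (hβ : ∀ v, d * β v = ∑ σ : Equiv.Perm (Fin l), (Equiv.Perm.sign σ : ℤ) * b (v ∘ σ))
    (v : Fin (k + l) → V) :
    c * d * wedge α β v = ∑ σ : Equiv.Perm (Fin (k + l)), (Equiv.Perm.sign σ : ℤ) *
      (a (fun i => v (σ (Fin.castAdd l i))) * b (fun i => v (σ (Fin.natAdd k i)))) := by
  have hα' : c • α.toAlternatingMap = MultilinearMap.alternatization a := by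
    ext v
    simpa [MultilinearMap.alternatization_apply, Units.smul_def] using! hα v
  have hβ' : d • β.toAlternatingMap = MultilinearMap.alternatization b := by
    ext v
    simpa [MultilinearMap.alternatization_apply, Units.smul_def] using! hβ v
  have h : (c * d) • α.toAlternatingMap.domCoprod β.toAlternatingMap =
      MultilinearMap.alternatization (MultilinearMap.domCoprod a b) := by
    rw [MultilinearMap.domCoprod_alternization, ← hα', ← hβ', ← AlternatingMap.domCoprod'_apply,
      ← AlternatingMap.domCoprod'_apply, TensorProduct.smul_tmul_smul, map_smul]
  have h' := congrArg (LinearMap.mul' ℝ ℝ)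
    (DFunLike.congr_fun h (fun i => v (finSumFinEquiv i)))
  rw [AlternatingMap.smul_apply, map_smul, smul_eq_mul, MultilinearMap.alternatization_apply,
    map_sum] at h'
  refine h'.trans ?_
  rw [← (Equiv.permCongr (finSumFinEquiv (m := k) (n := l))).sum_comp]
  refine Finset.sum_congr rfl fun σ _ => ?_
  rw [Units.smul_def, map_zsmul, zsmul_eq_mul, Equiv.Perm.sign_permCongr]
  congr 1
  simp [MultilinearMap.domCoprod_apply, Equiv.permCongr_apply]

theorem factorial_mul_wedge_apply {k l : ℕ} (α : V [⋀^Fin k]→L[ℝ] ℝ)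
    (β : V [⋀^Fin l]→L[ℝ] ℝ) (v : Fin (k + l) → V) :
    (k.factorial : ℝ) * l.factorial * wedge α β v =
      ∑ σ : Equiv.Perm (Fin (k + l)), (Equiv.Perm.sign σ : ℤ) *
        (α (fun i => v (σ (Fin.castAdd l i))) * β (fun i => v (σ (Fin.natAdd k i)))) :=
  wedge_apply_of_alternatization (a := α.toMultilinearMap) (b := β.toMultilinearMap)
    α.factorial_mul_apply β.factorial_mul_apply v

theorem factorial_mul_factorial_ne_zero (k l : ℕ) : (k.factorial : ℝ) * l.factorial ≠ 0 :=
  mul_ne_zero (Nat.cast_ne_zero.2 k.factorial_ne_zero) (Nat.cast_ne_zero.2 l.factorial_ne_zero)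

theorem wedge_smul_smul {k l : ℕ} (c d : ℝ) (α : V [⋀^Fin k]→L[ℝ] ℝ) (β : V [⋀^Fin l]→L[ℝ] ℝ) :
    wedge (c • α) (d • β) = (c * d) • wedge α β := by
  ext v
  apply mul_left_cancel₀ (factorial_mul_factorial_ne_zero k l)
  rw [factorial_mul_wedge_apply, ContinuousAlternatingMap.smul_apply, smul_eq_mul, mul_left_comm,
    factorial_mul_wedge_apply, Finset.mul_sum]
  refine Finset.sum_congr rfl fun σ _ => ?_
  simp only [ContinuousAlternatingMap.smul_apply, smul_eq_mul]
  ring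

theorem wedgePow_smul (c : ℝ) (η : V [⋀^Fin 2]→L[ℝ] ℝ) (m : ℕ) :
    wedgePow (c • η) m = c ^ m • wedgePow η m := by
  induction m with
  | zero => rw [pow_zero, one_smul]; rfl
  | succ m ih => rw [wedgePow, ih, wedge_smul_smul, pow_succ]; rfl

theorem wedge_sub_left {k l : ℕ} (α α' : V [⋀^Fin k]→L[ℝ] ℝ) (β : V [⋀^Fin l]→L[ℝ] ℝ)
    [IsTopologicalAddGroup V] :
    wedge (α - α') β = wedge α β - wedge α' β := by
  ext v
  apply mul_left_cancel₀ (factorial_mul_factorial_ne_zero k l)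
  rw [factorial_mul_wedge_apply, ContinuousAlternatingMap.sub_apply, mul_sub,
    factorial_mul_wedge_apply, factorial_mul_wedge_apply, ← Finset.sum_sub_distrib]
  refine Finset.sum_congr rfl fun σ _ => ?_
  simp only [ContinuousAlternatingMap.sub_apply]
  ring

variable {W : Type*} [AddCommGroup W] [Module ℝ W] [TopologicalSpace W]

theorem wedge_compContinuousLinearMap {k l : ℕ} (α : V [⋀^Fin k]→L[ℝ] ℝ)
    (β : V [⋀^Fin l]→L[ℝ] ℝ) (A : W →L[ℝ] V) :
    (wedge α β).compContinuousLinearMap A =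
      wedge (α.compContinuousLinearMap A) (β.compContinuousLinearMap A) := by
  ext v
  apply mul_left_cancel₀ (factorial_mul_factorial_ne_zero k l)
  rw [factorial_mul_wedge_apply, ContinuousAlternatingMap.compContinuousLinearMap_apply,
    factorial_mul_wedge_apply]
  rfl

theorem wedgePow_compContinuousLinearMap (η : V [⋀^Fin 2]→L[ℝ] ℝ) (A : W →L[ℝ] V) (m : ℕ) :
    (wedgePow η m).compContinuousLinearMap A = wedgePow (η.compContinuousLinearMap A) m := by
  induction m with
  | zero => rfl
  | succ m ih => rw [wedgePow, wedge_compContinuousLinearMap, ih]; rfl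

/-- `2 ^ m η ^ m` is the antisymmetrization of the `m`-fold tensor power of the `2`-form `η`. -/
theorem exists_wedgePow_apply_eq_sum (η : V [⋀^Fin 2]→L[ℝ] ℝ) (m : ℕ) :
    ∃ P : MultilinearMap ℝ (fun _ : Fin (2 * m) => V) ℝ,
      (∀ v, P v = ∏ i : Fin m, η ![v ⟨2 * i, by omega⟩, v ⟨2 * i + 1, by omega⟩]) ∧
      ∀ v, 2 ^ m * wedgePow η m v =
        ∑ σ : Equiv.Perm (Fin (2 * m)), (Equiv.Perm.sign σ : ℤ) * P (v ∘ σ) := by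
  induction m with
  | zero =>
    have : IsEmpty (Fin (2 * 0)) := Fin.isEmpty
    refine ⟨MultilinearMap.constOfIsEmpty ℝ _ 1, fun v => by simp, fun v => ?_⟩
    rw [Fintype.sum_subsingleton _ (1 : Equiv.Perm (Fin (2 * 0)))]
    simp [wedgePow]
  | succ m ih =>
    obtain ⟨P, hP, hη⟩ := ih
    refine ⟨((LinearMap.mul' ℝ ℝ).compMultilinearMap
      (P.domCoprod η.toMultilinearMap)).domDomCongr finSumFinEquiv, fun v => ?_, fun v => ?_⟩
    · rw [Fin.prod_univ_castSucc]
      simp only [MultilinearMap.domDomCongr_apply, LinearMap.compMultilinearMap_apply,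
        MultilinearMap.domCoprod_apply, LinearMap.mul'_apply, hP]
      congr 1
      refine congrArg η ?_
      ext i
      fin_cases i <;> rfl
    · have h := wedge_apply_of_alternatization (b := η.toMultilinearMap) hη
        η.factorial_mul_apply v
      rw [pow_succ]
      refine Eq.trans ?_ (h.trans ?_)
      · simp [wedgePow]
      · refine Finset.sum_congr rfl fun σ _ => ?_
        simp [MultilinearMap.domCoprod_apply]
        rfl

/-- The wedge product of a `1`-form with a power of a `2`-form as a sum over permutations. -/
theorem wedge_wedgePow_apply (α : V [⋀^Fin 1]→L[ℝ] ℝ) (η : V [⋀^Fin 2]→L[ℝ] ℝ) (m : ℕ)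
    (v : Fin (1 + 2 * m) → V) :
    2 ^ m * wedge α (wedgePow η m) v = ∑ σ : Equiv.Perm (Fin (1 + 2 * m)),
      (Equiv.Perm.sign σ : ℤ) * (α ![v (σ ⟨0, by omega⟩)] * ∏ i : Fin m,
        η ![v (σ ⟨1 + 2 * i, by omega⟩), v (σ ⟨1 + (2 * i + 1), by omega⟩)]) := by
  obtain ⟨P, hP, hη⟩ := exists_wedgePow_apply_eq_sum η m
  have h := wedge_apply_of_alternatization (a := α.toMultilinearMap) α.factorial_mul_apply hη v
  rw [Nat.factorial_one, Nat.cast_one, one_mul] at h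
  rw [h]
  refine Finset.sum_congr rfl fun σ _ => ?_
  rw [hP]
  congr 2
  refine congrArg α ?_
  ext i
  fin_cases i
  rfl

end WedgeFormula

/-! ### Injectivity of the Lefschetz map on `1`-forms -/

section Lefschetz

/-- A permutation of pairs `(i, b)` which maps each block `{(i, false), (i, true)}` onto another
block: it permutes the blocks, and its sign is the product of the signs by which it reorders them,
since a permutation of blocks of size two is even. -/
theorem sign_eq_prod_of_map_blocks {m : ℕ} (ρ : Equiv.Perm (Fin m × Bool)) (κ : Fin m → Fin m)
    (ε : Fin m → Bool) (h : ∀ i b, ρ (i, b) = (κ i, xor b (ε i))) :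
    Function.Bijective κ ∧ Equiv.Perm.sign ρ = ∏ i, if ε i then (-1 : ℤˣ) else 1 := by
  have hκ : Function.Bijective κ := by
    apply Finite.injective_iff_bijective.1
    intro i j hij
    have : ρ (i, ε i) = ρ (j, ε j) := by simp [h, hij]
    exact congrArg Prod.fst (ρ.injective this)
  refine ⟨hκ, ?_⟩
  set f : Fin m → Equiv.Perm Bool := fun i => if ε i then Equiv.swap false true else 1 with hf
  have hρ : ρ = (Equiv.prodCongrLeft fun _ : Bool => Equiv.ofBijective κ hκ) *
      Equiv.prodCongrRight f := by
    ext1 ⟨i, b⟩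
    rw [h]
    by_cases hi : ε i <;> cases b <;> simp [hf, hi]
  rw [hρ, Equiv.Perm.sign_mul, Equiv.Perm.sign_prodCongrLeft, Equiv.Perm.sign_prodCongrRight]
  simp only [Finset.prod_const, Finset.card_univ, Fintype.card_bool, Int.units_sq, one_mul]
  refine Finset.prod_congr rfl fun i _ => ?_
  by_cases hi : ε i <;> simp [hf, hi]

variable {V : Type*} [AddCommGroup V] [Module ℝ V] [TopologicalSpace V]

/-- For a vector `u none` and a symplectic family `u (some (i, b))` in its `η`-orthogonal, every
nonzero term of the sum over permutations computing `α ∧ η ^ m` is equal to the term of the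
identity. -/
theorem symplectic_term_eq {m : ℕ} (α : V [⋀^Fin 1]→L[ℝ] ℝ) (η : V [⋀^Fin 2]→L[ℝ] ℝ)
    (u : Option (Fin m × Bool) → V)
    (hu : ∀ a b, η ![u a, u b] ≠ 0 → ∃ k c, a = some (k, c) ∧ b = some (k, !c))
    (σ : Equiv.Perm (Option (Fin m × Bool)))
    (hσ : ∏ i, η ![u (σ (some (i, false))), u (σ (some (i, true)))] ≠ 0) :
    (Equiv.Perm.sign σ : ℤ) * (α ![u (σ none)] *
        ∏ i, η ![u (σ (some (i, false))), u (σ (some (i, true)))]) =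
      α ![u none] * ∏ i, η ![u (some (i, false)), u (some (i, true))] := by
  have h1 (i : Fin m) := hu _ _ (Finset.prod_ne_zero_iff.1 hσ i (Finset.mem_univ i))
  choose κ ε h2 h3 using h1
  have h4 (i : Fin m) (b : Bool) : σ (some (i, b)) = some (κ i, xor b (ε i)) := by
    cases b
    · simp [h2]
    · simp [h3]
  -- `σ` maps the blocks onto the blocks, which leaves only `none` as the image of `none`
  have h5 : σ none = none := by
    by_contra h
    obtain ⟨⟨k, c⟩, hk⟩ := Option.ne_none_iff_exists'.1 h
    have hinj : Function.Injective κ := by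
      intro i j hij
      have : σ (some (i, ε i)) = σ (some (j, ε j)) := by simp [h4, hij]
      exact congrArg Prod.fst (Option.some_injective _ (σ.injective this))
    obtain ⟨i, rfl⟩ := (Finite.injective_iff_surjective.1 hinj) k
    have : σ none = σ (some (i, xor c (ε i))) := by
      rw [hk, h4]
      simp
    simpa using σ.injective this
  have h6 : Equiv.optionCongr (Equiv.removeNone σ) = σ := by
    ext1 a
    cases a with
    | none => simp [h5]
    | some a => exact Equiv.removeNone_some σ ⟨_, h4 a.1 a.2⟩
  have h7 (i : Fin m) (b : Bool) : Equiv.removeNone σ (i, b) = (κ i, xor b (ε i)) := by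
    apply Option.some_injective
    rw [← h4]
    exact DFunLike.congr_fun h6 (some (i, b))
  obtain ⟨hκ, h8⟩ := sign_eq_prod_of_map_blocks _ κ ε h7
  have hswap (a b : V) : η ![b, a] = -η ![a, b] := by
    have := η.toAlternatingMap.map_swap ![a, b] (show (0 : Fin 2) ≠ 1 by decide)
    refine Eq.trans (congrArg η ?_) this
    ext i
    fin_cases i <;> simp
  rw [← h6, Equiv.optionCongr_sign, h8, h6, h5, mul_left_comm]
  congr 1
  rw [← (Equiv.ofBijective κ hκ).prod_comp
    fun i => η ![u (some (i, false)), u (some (i, true))], Units.coe_prod, Int.cast_prod,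
    ← Finset.prod_mul_distrib]
  refine Finset.prod_congr rfl fun i _ => ?_
  rw [h2, h3]
  cases hi : ε i
  · simp
  · simpa using! (hswap _ _).symm

/-- The value of `α ∧ η ^ m` on a vector `u none` and a symplectic family `u (some (i, b))` in its
`η`-orthogonal is a nonzero multiple of `α (u none)`: no two of the nonzero terms cancel. -/
theorem wedge_wedgePow_ne_zero {m : ℕ} (α : V [⋀^Fin 1]→L[ℝ] ℝ) (η : V [⋀^Fin 2]→L[ℝ] ℝ)
    (u : Option (Fin m × Bool) → V)
    (hu : ∀ a b, η ![u a, u b] ≠ 0 → ∃ k c, a = some (k, c) ∧ b = some (k, !c))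
    (hu' : ∀ i, η ![u (some (i, false)), u (some (i, true))] ≠ 0) (hα : α ![u none] ≠ 0) :
    wedge α (wedgePow η m) ≠ 0 := by
  classical
  -- the slot `0` is for `α`, and the slots `1 + 2 i`, `2 + 2 i` are for the `i`-th factor `η`
  set j : Option (Fin m × Bool) → Fin (1 + 2 * m) := fun a =>
    a.elim ⟨0, by omega⟩ fun p => ⟨1 + (2 * p.1 + p.2.toNat), by grind [Bool.toNat_le]⟩ with hj
  have hinj : Function.Injective j := by
    rintro (_ | ⟨i, _ | _⟩) (_ | ⟨i', _ | _⟩) h <;> simp [hj, Fin.ext_iff] at h ⊢ <;> omega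
  have hbij : Function.Bijective j :=
    (Fintype.bijective_iff_injective_and_card j).2 ⟨hinj, by simp; ring⟩
  set e := Equiv.ofBijective j hbij
  intro h0
  have h := wedge_wedgePow_apply α η m (u ∘ e.symm)
  rw [h0, show (0 : V [⋀^Fin (1 + 2 * m)]→L[ℝ] ℝ) (u ∘ e.symm) = 0 from rfl, mul_zero,
    ← (Equiv.permCongr e).sum_comp] at h
  set C := α ![u none] * ∏ i, η ![u (some (i, false)), u (some (i, true))]
  have hC : C ≠ 0 := mul_ne_zero hα (Finset.prod_ne_zero_iff.2 fun i _ => hu' i)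
  set Q : Equiv.Perm (Option (Fin m × Bool)) → ℝ := fun σ =>
    ∏ i, η ![u (σ (some (i, false))), u (σ (some (i, true)))] with hQ
  have hterm (σ : Equiv.Perm (Option (Fin m × Bool))) :
      (Equiv.Perm.sign σ : ℤ) * (α ![u (σ none)] * Q σ) = C * if Q σ ≠ 0 then 1 else 0 := by
    by_cases hσ : Q σ = 0
    · simp [hσ]
    · rw [if_pos hσ, mul_one]
      exact symplectic_term_eq α η u hu σ hσ
  have h1 : ∑ σ : Equiv.Perm (Option (Fin m × Bool)),
      (Equiv.Perm.sign σ : ℤ) * (α ![u (σ none)] * Q σ) = 0 := by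
    refine Eq.trans (Finset.sum_congr rfl fun σ _ => ?_) h.symm
    have e0 : e.symm ⟨0, by omega⟩ = none := e.symm_apply_eq.2 rfl
    have e1 (i : Fin m) : e.symm ⟨1 + 2 * i, by omega⟩ = some (i, false) :=
      e.symm_apply_eq.2 rfl
    have e2 (i : Fin m) : e.symm ⟨1 + (2 * i + 1), by omega⟩ = some (i, true) :=
      e.symm_apply_eq.2 rfl
    simp only [Equiv.Perm.sign_permCongr, Equiv.permCongr_apply, Function.comp_apply,
      Equiv.symm_apply_apply, e0, e1, e2, hQ]
  simp only [hterm, ← Finset.mul_sum, mul_eq_zero, hC, false_or, Finset.sum_boole,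
    Nat.cast_eq_zero, Finset.card_eq_zero] at h1
  have h2 := Finset.filter_eq_empty_iff.1 h1 (Finset.mem_univ 1)
  exact h2 (Finset.prod_ne_zero_iff.2 fun i _ => hu' i)

variable [FiniteDimensional ℝ V]

/-- In a Hermitian vector space of complex dimension `m + 1`, a nonzero vector is the first element
of a unitary family of `k + 1 ≤ m + 1` vectors, up to normalization. -/
theorem exists_unitary_family {m : ℕ} (hV : Module.finrank ℝ V = 2 * (m + 1))
    (g : V →L[ℝ] V →L[ℝ] ℝ) (J : V →L[ℝ] V) (hsymm : ∀ v w, g v w = g w v)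
    (hJ : ∀ v, J (J v) = -v) (hgJ : ∀ v w, g (J v) (J w) = g v w) (X : V) (hX : X ≠ 0)
    (k : ℕ) (hk : k ≤ m) :
    ∃ f : Fin (k + 1) → V, f 0 = X ∧ (∀ i, f i ≠ 0) ∧
      ∀ i j, i ≠ j → g (f i) (f j) = 0 ∧ g (J (f i)) (f j) = 0 := by
  induction k with
  | zero => exact ⟨fun _ => X, rfl, fun _ => hX, fun i j h =>
    absurd ((Fin.fin_one_eq_zero i).trans (Fin.fin_one_eq_zero j).symm) h⟩
  | succ k ih =>
    obtain ⟨f, h0, hf, hg⟩ := ih (by omega)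
    -- the orthogonal of the complex span of the family is cut out by `2 (k + 1)` equations
    let A : V →ₗ[ℝ] (Fin (k + 1) → ℝ × ℝ) :=
      LinearMap.pi fun i => ((g (f i)).toLinearMap).prod ((g (J (f i))).toLinearMap)
    obtain ⟨w, hw, hw0⟩ : ∃ w, A w = 0 ∧ w ≠ 0 := by
      have : LinearMap.ker A ≠ ⊥ := by
        apply LinearMap.ker_ne_bot_of_finrank_lt
        simp only [Module.finrank_pi_fintype, Module.finrank_prod, Module.finrank_self]
        simp
        omega
      obtain ⟨w, hw, hw0⟩ := (Submodule.ne_bot_iff _).1 this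
      exact ⟨w, hw, hw0⟩
    have hw1 (i : Fin (k + 1)) : g (f i) w = 0 := congrArg Prod.fst (congrFun hw i)
    have hw2 (i : Fin (k + 1)) : g (J (f i)) w = 0 := congrArg Prod.snd (congrFun hw i)
    have hw3 (i : Fin (k + 1)) : g (J w) (f i) = 0 := by
      rw [← hgJ, hJ, map_neg, neg_apply, hsymm, hw2, neg_zero]
    refine ⟨Fin.snoc f w, ?_, fun i => ?_, fun i j hij => ?_⟩
    · exact (Fin.snoc_castSucc (α := fun _ => V) w f 0).trans h0
    · cases i using Fin.lastCases <;> simp [hf, hw0]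
    · cases i using Fin.lastCases with
      | last =>
        cases j using Fin.lastCases with
        | last => exact absurd rfl hij
        | cast j => simp [hw3, hsymm w, hw1]
      | cast i =>
        cases j using Fin.lastCases with
        | last => simp [hw1, hw2]
        | cast j => simpa using hg i j fun h => hij (congrArg _ h)

/-- Injectivity of the Lefschetz map `α ↦ α ∧ η ^ (n - 1)` on `1`-forms, on a Hermitian vector space
of complex dimension `n = m + 1` with fundamental form `ω = g(J ·, ·)`. -/
theorem eq_zero_of_wedge_wedgePow_eq_zero {m : ℕ} (hV : Module.finrank ℝ V = 2 * (m + 1))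
    (g : V →L[ℝ] V →L[ℝ] ℝ) (J : V →L[ℝ] V) (hsymm : ∀ v w, g v w = g w v)
    (hpos : ∀ v, v ≠ 0 → 0 < g v v)
    (hJ : ∀ v, J (J v) = -v) (hgJ : ∀ v w, g (J v) (J w) = g v w)
    (η : V [⋀^Fin 2]→L[ℝ] ℝ) (hη : ∀ v, η v = g (J (v 0)) (v 1))
    (α : V [⋀^Fin 1]→L[ℝ] ℝ) (h : wedge α (wedgePow η m) = 0) : α = 0 := by
  by_contra hα
  obtain ⟨X, hX⟩ : ∃ X, α ![X] ≠ 0 := by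
    by_contra! hα'
    refine hα (ContinuousAlternatingMap.ext fun v => ?_)
    have hv : ![v 0] = v := by
      ext i
      fin_cases i
      rfl
    exact hv ▸ hα' (v 0)
  have hX0 : X ≠ 0 := by
    rintro rfl
    exact hX (α.map_coord_zero 0 rfl)
  obtain ⟨f, h0, hf, hg⟩ := exists_unitary_family hV g J hsymm hJ hgJ X hX0 m le_rfl
  have hself (v : V) : g (J v) v = 0 := by
    have := hgJ (J v) v
    rw [hJ, map_neg, neg_apply, hsymm] at this
    linarith
  let u : Option (Fin m × Bool) → V := fun a =>
    a.elim X fun p => if p.2 then J (f p.1.succ) else f p.1.succ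
  refine wedge_wedgePow_ne_zero α η u ?_ ?_ hX h
  · have h0' (i : Fin m) := hg 0 i.succ (Fin.succ_ne_zero i).symm
    have h0'' (i : Fin m) := hg i.succ 0 (Fin.succ_ne_zero i)
    rw [h0] at h0' h0''
    have hne {i j : Fin m} (hij : i ≠ j) := hg i.succ j.succ fun h => hij (Fin.succ_injective _ h)
    rintro (_ | ⟨i, b⟩) (_ | ⟨j, c⟩) hab
    · simp [hη, u, hself] at hab
    · cases c <;> simp [hη, u, hgJ, h0'] at hab
    · cases b <;> simp [hη, u, hJ, h0''] at hab
    · by_cases hij : i = j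
      · subst hij
        cases b <;> cases c <;> simp [hη, u, hself, hJ, hgJ] at hab ⊢
        rw [hsymm] at hab
        exact hab (hself _)
      · cases b <;> cases c <;> simp [hη, u, hJ, hgJ, hne hij] at hab
        rw [hsymm] at hab
        exact absurd (hne (Ne.symm hij)).2 hab
  · intro i
    simpa [hη, u, hgJ] using (hpos _ (hf i.succ)).ne'

end Lefschetz

/-! ### Left-invariant forms on a Lie group -/

section Pullback

variable {E : Type*} [NormedAddCommGroup E] [NormedSpace ℝ E]

/-- The pullback formula for the exterior derivative, for a local diffeomorphism `Φ` with local
inverse `Ψ`. No differentiability of the forms is needed: `α` is differentiable at `y` if and only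
if `β` is at `Φ y`, and otherwise both exterior derivatives vanish by convention. -/
theorem extDeriv_eq_of_eventuallyEq_pullback {k : ℕ} {α β : E → E [⋀^Fin k]→L[ℝ] ℝ}
    {Φ Ψ : E → E} {y : E} (hΦ : ContDiffAt ℝ ∞ Φ y) (hΨ : ContDiffAt ℝ ∞ Ψ (Φ y))
    (hy : Ψ (Φ y) = y)
    (hα : ∀ᶠ z in 𝓝 y, α z = (β (Φ z)).compContinuousLinearMap (fderiv ℝ Φ z))
    (hβ : ∀ᶠ z in 𝓝 (Φ y), β z = (α (Ψ z)).compContinuousLinearMap (fderiv ℝ Ψ z)) :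
    extDeriv α y = (extDeriv β (Φ y)).compContinuousLinearMap (fderiv ℝ Φ y) := by
  have key {α β : E → E [⋀^Fin k]→L[ℝ] ℝ} {Φ : E → E} {y : E} (hΦ : ContDiffAt ℝ ∞ Φ y)
      (hα : ∀ᶠ z in 𝓝 y, α z = (β (Φ z)).compContinuousLinearMap (fderiv ℝ Φ z))
      (hβ : DifferentiableAt ℝ β (Φ y)) : DifferentiableAt ℝ α y := by
    refine DifferentiableAt.congr_of_eventuallyEq ?_ hα
    refine DifferentiableAt.continuousAlternatingMapCompContinuousLinearMap
      (hβ.comp y (hΦ.differentiableAt (by simp))) ?_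
    exact (hΦ.fderiv_right (m := 1) (by norm_cast)).differentiableAt one_ne_zero
  by_cases h : DifferentiableAt ℝ β (Φ y)
  · rw [Filter.EventuallyEq.extDeriv_eq hα]
    exact extDeriv_pullback h hΦ (by
      rw [minSmoothness_of_isRCLikeNormedField]
      norm_cast)
  · have h' : ¬ DifferentiableAt ℝ α y := fun h' => h (key hΨ hβ (by rwa [hy]))
    simp only [extDeriv, fderiv_zero_of_not_differentiableAt h,
      fderiv_zero_of_not_differentiableAt h']
    have h0 : (ContinuousAlternatingMap.alternatizeUncurryFin 0 : E [⋀^Fin (k + 1)]→L[ℝ] ℝ) = 0 :=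
      (ContinuousAlternatingMap.alternatizeUncurryFinCLM ℝ E ℝ).map_zero
    rw [h0]
    rfl

end Pullback

section LieGroup

theorem DiffForm.apply_congr {E : Type*} [NormedAddCommGroup E] [NormedSpace ℝ E]
    {M : Type*} [TopologicalSpace M] [ChartedSpace E M] {k : ℕ} (α : DiffForm E M k) {x x' : M}
    (h : x = x') (v : Fin k → E) : α x v = α x' v := by
  subst h
  rfl

variable {E : Type*} [NormedAddCommGroup E] [NormedSpace ℝ E]
  {G : Type*} [Group G] [TopologicalSpace G] [ChartedSpace E G] [LieGroup 𝓘(ℝ, E) ∞ G]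

/-- A differential form on `G` is left-invariant if it is preserved by the left translations. -/
def DiffForm.IsLeftInvariant {k : ℕ} (ζ : DiffForm E G k) : Prop :=
  ∀ g p : G, (ζ (g * p)).compContinuousLinearMap (mfderiv 𝓘(ℝ, E) 𝓘(ℝ, E) (g * ·) p) = ζ p

/-- The left translation by `g`, in the preferred charts at `p` and `g * p`. -/
def mulLeftInChart (g p : G) (y : E) : E :=
  extChartAt 𝓘(ℝ, E) (g * p) (g * (extChartAt 𝓘(ℝ, E) p).symm y)

omit [LieGroup 𝓘(ℝ, E) ∞ G] in
theorem mulLeftInChart_self (g p : G) :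
    mulLeftInChart (E := E) g p (extChartAt 𝓘(ℝ, E) p p) = extChartAt 𝓘(ℝ, E) (g * p) (g * p) := by
  rw [mulLeftInChart, extChartAt_to_inv]

theorem eventually_mem_source_of_mulLeft (g p : G) :
    ∀ᶠ y in 𝓝 (extChartAt 𝓘(ℝ, E) p p), y ∈ (extChartAt 𝓘(ℝ, E) p).target ∧
      g * (extChartAt 𝓘(ℝ, E) p).symm y ∈ (extChartAt 𝓘(ℝ, E) (g * p)).source := by
  have : IsTopologicalGroup G := topologicalGroup_of_lieGroup 𝓘(ℝ, E) ∞
  refine Filter.Eventually.and (extChartAt_target_mem_nhds p) ?_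
  have hc : ContinuousAt (fun y => g * (extChartAt 𝓘(ℝ, E) p).symm y)
      (extChartAt 𝓘(ℝ, E) p p) := (continuousAt_extChartAt_symm p).const_mul g
  apply hc.eventually
  simp only [extChartAt_to_inv]
  exact extChartAt_source_mem_nhds (g * p)

theorem mdifferentiableAt_extChartAt_symm {M : Type*} [TopologicalSpace M] [ChartedSpace E M]
    [IsManifold 𝓘(ℝ, E) ∞ M] {p : M} {y : E} (hy : y ∈ (extChartAt 𝓘(ℝ, E) p).target) :
    MDifferentiableAt 𝓘(ℝ, E) 𝓘(ℝ, E) (extChartAt 𝓘(ℝ, E) p).symm y :=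
  ((contMDiffOn_extChartAt_symm (n := ∞) p).contMDiffAt
    ((isOpen_extChartAt_target p).mem_nhds hy)).mdifferentiableAt (by simp)

theorem mdifferentiableAt_translation (g p : G) :
    MDifferentiableAt 𝓘(ℝ, E) 𝓘(ℝ, E) (g * ·) p :=
  (contMDiff_mul_left (I := 𝓘(ℝ, E)) (n := ∞)).contMDiffAt.mdifferentiableAt (by simp)

theorem contMDiffAt_mulLeftInChart (g p : G) {y : E} (hy : y ∈ (extChartAt 𝓘(ℝ, E) p).target)
    (hgy : g * (extChartAt 𝓘(ℝ, E) p).symm y ∈ (extChartAt 𝓘(ℝ, E) (g * p)).source) :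
    ContMDiffAt 𝓘(ℝ, E) 𝓘(ℝ, E) ∞ (mulLeftInChart (E := E) g p) y := by
  have h1 := (contMDiffOn_extChartAt_symm (I := 𝓘(ℝ, E)) (n := ∞) p).contMDiffAt
    ((isOpen_extChartAt_target p).mem_nhds hy)
  have h2 := (contMDiff_mul_left (I := 𝓘(ℝ, E)) (n := ∞) (a := g)).contMDiffAt
    (x := (extChartAt 𝓘(ℝ, E) p).symm y)
  have h3 := contMDiffAt_extChartAt' (I := 𝓘(ℝ, E)) (n := ∞) (x := g * p)
    (by simpa using hgy)
  exact h3.comp y (h2.comp y h1)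

theorem DiffForm.IsLeftInvariant.inChart_eventuallyEq {k : ℕ} {ζ : DiffForm E G k}
    (hζ : ζ.IsLeftInvariant) (g p : G) :
    ∀ᶠ y in 𝓝 (extChartAt 𝓘(ℝ, E) p p), ζ.inChart p y =
      (ζ.inChart (g * p) (mulLeftInChart g p y)).compContinuousLinearMap
        (fderiv ℝ (mulLeftInChart g p) y) := by
  filter_upwards [(eventually_mem_source_of_mulLeft g p).eventually_nhds] with y hy
  obtain ⟨hy1, hy2⟩ := hy.self_of_nhds
  set a := extChartAt 𝓘(ℝ, E) p with ha
  set b := extChartAt 𝓘(ℝ, E) (g * p) with hb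
  have hr : b.symm (mulLeftInChart g p y) = g * a.symm y := b.left_inv hy2
  have hd : mulLeftInChart g p y ∈ b.target := b.map_source hy2
  -- both sides differentiate `y ↦ g * a.symm y`
  have h1 : mfderiv 𝓘(ℝ, E) 𝓘(ℝ, E) (b.symm ∘ mulLeftInChart g p) y =
      mfderiv 𝓘(ℝ, E) 𝓘(ℝ, E) ((g * ·) ∘ a.symm) y := by
    apply Filter.EventuallyEq.mfderiv_eq
    filter_upwards [hy] with z hz using b.left_inv hz.2
  rw [mfderiv_comp y (mdifferentiableAt_extChartAt_symm hd)
      ((contMDiffAt_mulLeftInChart g p hy1 hy2).mdifferentiableAt (by simp)),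
    mfderiv_comp y (mdifferentiableAt_translation g _) (mdifferentiableAt_extChartAt_symm hy1),
    mfderiv_eq_fderiv] at h1
  ext v
  have h2 (w : E) := DFunLike.congr_fun h1 w
  refine (DFunLike.congr_fun (hζ g (a.symm y)) _).symm.trans ?_
  refine Eq.trans ?_ (DiffForm.apply_congr ζ hr _).symm
  refine congrArg (ζ (g * a.symm y)) (funext fun i => ?_)
  exact (h2 (v i)).symm

/-- The exterior derivative commutes with left translations. -/
theorem DiffForm.IsLeftInvariant.extD {k : ℕ} {ζ : DiffForm E G k} (hζ : ζ.IsLeftInvariant) :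
    ζ.extD.IsLeftInvariant := by
  intro g p
  set a := extChartAt 𝓘(ℝ, E) p with ha
  set b := extChartAt 𝓘(ℝ, E) (g * p) with hb
  set Φ : E → E := mulLeftInChart g p with hΦ
  have hy := eventually_mem_source_of_mulLeft (E := E) g p
  obtain ⟨hy1, hy2⟩ := hy.self_of_nhds
  have hΦa : Φ (a p) = b (g * p) := mulLeftInChart_self g p
  have hinv : g⁻¹ * (g * p) = p := inv_mul_cancel_left g p
  set Ψ : E → E := fun y => a (g⁻¹ * b.symm y) with hΨ
  have hΨ' : mulLeftInChart g⁻¹ (g * p) = Ψ := by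
    funext y
    rw [mulLeftInChart, hinv]
  have hsm := contMDiffAt_mulLeftInChart g p hy1 hy2
  have key : extDeriv (ζ.inChart p) (a p) =
      (extDeriv (ζ.inChart (g * p)) (Φ (a p))).compContinuousLinearMap (fderiv ℝ Φ (a p)) := by
    apply extDeriv_eq_of_eventuallyEq_pullback (Ψ := Ψ) hsm.contDiffAt
    · rw [mulLeftInChart_self, ← hΨ']
      have h := (eventually_mem_source_of_mulLeft (E := E) g⁻¹ (g * p)).self_of_nhds
      exact (contMDiffAt_mulLeftInChart g⁻¹ (g * p) h.1 h.2).contDiffAt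
    · rw [mulLeftInChart_self, hΨ]
      simp only [hb, ha]
      rw [ extChartAt_to_inv, hinv]
    · exact hζ.inChart_eventuallyEq g p
    · have h := hζ.inChart_eventuallyEq g⁻¹ (g * p)
      rw [mulLeftInChart_self, ← hΨ']
      rwa [hinv] at h
  have h1 : mfderiv 𝓘(ℝ, E) 𝓘(ℝ, E) (Φ ∘ a) p = mfderiv 𝓘(ℝ, E) 𝓘(ℝ, E) (b ∘ (g * ·)) p := by
    apply Filter.EventuallyEq.mfderiv_eq
    filter_upwards [extChartAt_source_mem_nhds (I := 𝓘(ℝ, E)) p] with r hr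
    change b (g * a.symm (a r)) = b (g * r)
    rw [a.left_inv hr]
  rw [mfderiv_comp p (hsm.mdifferentiableAt (by simp))
      (mdifferentiableAt_extChartAt (mem_chart_source E p)),
    mfderiv_comp p (mdifferentiableAt_extChartAt (mem_chart_source E (g * p)))
      (mdifferentiableAt_translation g p), mfderiv_eq_fderiv] at h1
  ext v
  have h2 (w : E) := DFunLike.congr_fun h1 w
  change extDeriv (ζ.inChart (g * p)) (b (g * p)) (fun i =>
      mfderiv 𝓘(ℝ, E) 𝓘(ℝ, E) b (g * p) (mfderiv 𝓘(ℝ, E) 𝓘(ℝ, E) (g * ·) p (v i))) =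
    extDeriv (ζ.inChart p) (a p) (fun i => mfderiv 𝓘(ℝ, E) 𝓘(ℝ, E) a p (v i))
  rw [key, hΦa]
  refine congrArg (extDeriv (ζ.inChart (g * p)) (b (g * p))) (funext fun i => ?_)
  exact (h2 (v i)).symm

end LieGroup

/-! ### The projection from `G` to `Γ \ G` and invariant frames -/

section Projection

variable {E : Type*} [NormedAddCommGroup E] [NormedSpace ℝ E]
  {G : Type*} [Group G] [TopologicalSpace G] [ChartedSpace E G] [LieGroup 𝓘(ℝ, E) ∞ G]
  (Γ : Subgroup G) [DiscreteTopology Γ]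

/-- A point `p` of `G` is distinguished if it is the representative of `π(p)` that was chosen in the
construction of the charts of `Γ \ G`: the preferred chart at `π(p)` is then the preferred chart at
`p` read through `π`. Every point of `Γ \ G` is the image of a distinguished point. -/
def LeftQuotient.IsDistinguished (p : G) : Prop :=
  (LeftQuotient.proj_surjective Γ).hasRightInverse.choose (LeftQuotient.proj Γ p) = p

omit [TopologicalSpace G] [DiscreteTopology Γ] in
theorem LeftQuotient.exists_isDistinguished (x : LeftQuotient Γ) :
    ∃ p : G, LeftQuotient.IsDistinguished Γ p ∧ LeftQuotient.proj Γ p = x := by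
  have h := (LeftQuotient.proj_surjective Γ).hasRightInverse.choose_spec
  exact ⟨_, congrArg _ (h x), h x⟩

variable {Γ}

theorem LeftQuotient.IsDistinguished.exists_chartAt_eq {p : G}
    (hp : LeftQuotient.IsDistinguished Γ p) :
    ∃ φ : OpenPartialHomeomorph (LeftQuotient Γ) G, p ∈ φ.target ∧
      (∀ r, φ.symm r = LeftQuotient.proj Γ r) ∧
      chartAt E (LeftQuotient.proj Γ p) = φ.trans (chartAt E p) := by
  have : IsTopologicalGroup G := topologicalGroup_of_lieGroup 𝓘(ℝ, E) ∞
  have h := LeftQuotient.isLocalHomeomorph_proj Γ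
  refine ⟨h.localInverseAt p, h.self_mem_localInverseAt_target, fun r => ?_, ?_⟩
  · rw [h.localInverseAt_symm]
  · have h' : chartAt E (LeftQuotient.proj Γ p) = (h.localInverseAt
        ((LeftQuotient.proj_surjective Γ).hasRightInverse.choose (LeftQuotient.proj Γ p))).trans
        (chartAt E ((LeftQuotient.proj_surjective Γ).hasRightInverse.choose
          (LeftQuotient.proj Γ p))) := rfl
    rw [h', hp]

theorem LeftQuotient.IsDistinguished.extChartAt_symm {p : G}
    (hp : LeftQuotient.IsDistinguished Γ p) :
    ((extChartAt 𝓘(ℝ, E) (LeftQuotient.proj Γ p)).symm : E → LeftQuotient Γ) =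
      LeftQuotient.proj Γ ∘ (extChartAt 𝓘(ℝ, E) p).symm := by
  obtain ⟨φ, -, hφ, h⟩ := hp.exists_chartAt_eq (E := E)
  ext y
  simp [extChartAt, h, hφ]

theorem LeftQuotient.IsDistinguished.extChartAt_proj_eventuallyEq {p : G}
    (hp : LeftQuotient.IsDistinguished Γ p) :
    extChartAt 𝓘(ℝ, E) (LeftQuotient.proj Γ p) ∘ LeftQuotient.proj Γ =ᶠ[𝓝 p]
      extChartAt 𝓘(ℝ, E) p := by
  obtain ⟨φ, hpφ, hφ, h⟩ := hp.exists_chartAt_eq (E := E)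
  filter_upwards [φ.open_target.mem_nhds hpφ] with r hr
  have hr' : φ (LeftQuotient.proj Γ r) = r := by rw [← hφ, φ.right_inv hr]
  simp [extChartAt, h, hr']

theorem LeftQuotient.IsDistinguished.eventually_mdifferentiableAt_proj {p : G}
    (hp : LeftQuotient.IsDistinguished Γ p) :
    ∀ᶠ r in 𝓝 p, MDifferentiableAt 𝓘(ℝ, E) 𝓘(ℝ, E) (LeftQuotient.proj Γ) r := by
  have hc : ContinuousAt (extChartAt 𝓘(ℝ, E) p) p := continuousAt_extChartAt p
  have hmem : ∀ᶠ r in 𝓝 p, extChartAt 𝓘(ℝ, E) p r ∈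
      (extChartAt 𝓘(ℝ, E) (LeftQuotient.proj Γ p)).target := by
    apply hc.eventually
    rw [← hp.extChartAt_proj_eventuallyEq.self_of_nhds]
    exact extChartAt_target_mem_nhds _
  filter_upwards [hmem, eventually_mem_nhds_iff.2
    (extChartAt_source_mem_nhds (I := 𝓘(ℝ, E)) p)] with r h1 h2
  have h3 := (mdifferentiableAt_extChartAt_symm h1).comp r
    (mdifferentiableAt_extChartAt (I := 𝓘(ℝ, E)) (by simpa using mem_of_mem_nhds h2))
  refine h3.congr_of_eventuallyEq ?_
  filter_upwards [h2] with r' hr'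
  rw [hp.extChartAt_symm]
  exact congrArg _ ((extChartAt 𝓘(ℝ, E) p).left_inv hr').symm

theorem LeftQuotient.IsDistinguished.mfderiv_extChartAt_proj_apply {p : G}
    (hp : LeftQuotient.IsDistinguished Γ p) (v : TangentSpace 𝓘(ℝ, E) p) :
    mfderiv 𝓘(ℝ, E) 𝓘(ℝ, E) (extChartAt 𝓘(ℝ, E) (LeftQuotient.proj Γ p)) (LeftQuotient.proj Γ p)
      (mfderiv 𝓘(ℝ, E) 𝓘(ℝ, E) (LeftQuotient.proj Γ) p v) =
      mfderiv 𝓘(ℝ, E) 𝓘(ℝ, E) (extChartAt 𝓘(ℝ, E) p) p v := by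
  have h := (hp.extChartAt_proj_eventuallyEq (E := E)).mfderiv_eq (I := 𝓘(ℝ, E)) (I' := 𝓘(ℝ, E))
  rw [mfderiv_comp p (mdifferentiableAt_extChartAt (mem_chart_source E _))
    hp.eventually_mdifferentiableAt_proj.self_of_nhds] at h
  exact DFunLike.congr_fun h v

theorem LeftQuotient.IsDistinguished.bijective_mfderiv_proj {p : G}
    (hp : LeftQuotient.IsDistinguished Γ p) :
    Function.Bijective (mfderiv 𝓘(ℝ, E) 𝓘(ℝ, E) (LeftQuotient.proj Γ) p) := by
  -- both tangent spaces are identified with `E` through charts that correspond under `π`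
  have h : ∀ v : E, mfderiv 𝓘(ℝ, E) 𝓘(ℝ, E) (LeftQuotient.proj Γ) p v = v := by
    intro v
    have h := hp.mfderiv_extChartAt_proj_apply (E := E) v
    rw [mfderiv_extChartAt_self, mfderiv_extChartAt_self] at h
    exact h
  exact (show (mfderiv 𝓘(ℝ, E) 𝓘(ℝ, E) (LeftQuotient.proj Γ) p : E → E) = id from funext h) ▸
    Function.bijective_id

/-- The pullback to `G` of a differential form on `Γ \ G`. -/
def DiffForm.pullbackProj {k : ℕ} (α : DiffForm E (LeftQuotient Γ) k) : DiffForm E G k := fun p =>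
  (α (LeftQuotient.proj Γ p)).compContinuousLinearMap
    (mfderiv 𝓘(ℝ, E) 𝓘(ℝ, E) (LeftQuotient.proj Γ) p)

/-- The exterior derivative commutes with the pullback to `G`. Distinguished points suffice below,
since their images are all the points of `Γ \ G`. -/
theorem LeftQuotient.IsDistinguished.extD_pullbackProj {k : ℕ}
    (α : DiffForm E (LeftQuotient Γ) k) {p : G} (hp : LeftQuotient.IsDistinguished Γ p) :
    α.extD.pullbackProj p = α.pullbackProj.extD p := by
  have h1 : α.inChart (LeftQuotient.proj Γ p) =ᶠ[𝓝 (extChartAt 𝓘(ℝ, E) p p)]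
      α.pullbackProj.inChart p := by
    have hc : ContinuousAt (extChartAt 𝓘(ℝ, E) p).symm (extChartAt 𝓘(ℝ, E) p p) :=
      continuousAt_extChartAt_symm p
    have hd := hp.eventually_mdifferentiableAt_proj (E := E)
    rw [← extChartAt_to_inv (I := 𝓘(ℝ, E)) p] at hd
    filter_upwards [hc.eventually hd, extChartAt_target_mem_nhds p] with y hy hy'
    ext v
    unfold DiffForm.inChart
    rw [hp.extChartAt_symm, mfderiv_comp y hy (mdifferentiableAt_extChartAt_symm hy')]
    rfl
  have h2 : extChartAt 𝓘(ℝ, E) (LeftQuotient.proj Γ p) (LeftQuotient.proj Γ p) =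
      extChartAt 𝓘(ℝ, E) p p := hp.extChartAt_proj_eventuallyEq.self_of_nhds
  ext v
  change extDeriv (α.inChart (LeftQuotient.proj Γ p))
      (extChartAt 𝓘(ℝ, E) (LeftQuotient.proj Γ p) (LeftQuotient.proj Γ p))
      (fun i => mfderiv 𝓘(ℝ, E) 𝓘(ℝ, E) (extChartAt 𝓘(ℝ, E) (LeftQuotient.proj Γ p))
        (LeftQuotient.proj Γ p) (mfderiv 𝓘(ℝ, E) 𝓘(ℝ, E) (LeftQuotient.proj Γ) p (v i))) =
    extDeriv (α.pullbackProj.inChart p) (extChartAt 𝓘(ℝ, E) p p)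
      (fun i => mfderiv 𝓘(ℝ, E) 𝓘(ℝ, E) (extChartAt 𝓘(ℝ, E) p) p (v i))
  rw [h2, h1.extDeriv_eq]
  exact congrArg _ (funext fun i => hp.mfderiv_extChartAt_proj_apply (v i))

/-- The value at `p` of left-invariant vector fields, as a map on the Lie algebra. -/
def leftTranslation (p : G) : GroupLieAlgebra 𝓘(ℝ, E) G →L[ℝ] TangentSpace 𝓘(ℝ, E) p :=
  mfderiv 𝓘(ℝ, E) 𝓘(ℝ, E) (p * ·) (1 : G)

theorem mfderiv_mul_left_leftTranslation (g p : G) (v : GroupLieAlgebra 𝓘(ℝ, E) G) :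
    mfderiv 𝓘(ℝ, E) 𝓘(ℝ, E) (g * ·) p (leftTranslation p v) = leftTranslation (g * p) v := by
  have h := mfderiv_comp_of_eq (f := (p * ·)) (g := (g * ·)) (x := (1 : G)) (y := p)
    (mdifferentiableAt_translation (E := E) g p) (mdifferentiableAt_translation (E := E) p 1)
    (mul_one p)
  have h1 : (g * ·) ∘ (p * ·) = (g * p * ·) := funext fun r => (mul_assoc g p r).symm
  rw [h1] at h
  have h2 := DFunLike.congr_fun h v
  have h3 : ∀ p', p' = p → ∀ w : E, (mfderiv 𝓘(ℝ, E) 𝓘(ℝ, E) (g * ·) p w : E) =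
      mfderiv 𝓘(ℝ, E) 𝓘(ℝ, E) (g * ·) p' w := by
    rintro _ rfl w
    rfl
  exact (h3 (p * 1) (mul_one p) _).trans h2.symm

omit [LieGroup 𝓘(ℝ, E) ∞ G] in
theorem leftTranslation_one (v : GroupLieAlgebra 𝓘(ℝ, E) G) : leftTranslation (1 : G) v = v := by
  have : (fun r : G => 1 * r) = id := funext one_mul
  rw [leftTranslation, this, mfderiv_id]
  rfl

theorem bijective_leftTranslation [FiniteDimensional ℝ E] (p : G) :
    Function.Bijective (leftTranslation (E := E) p) := by
  have hinj : Function.Injective (leftTranslation (E := E) p) := by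
    have h : ∀ v : E, (mfderiv 𝓘(ℝ, E) 𝓘(ℝ, E) (p⁻¹ * ·) p (leftTranslation p v) : E) = v := by
      intro v
      have h1 : ∀ p' : G, p' = 1 → (leftTranslation p' v : E) = v := by
        rintro _ rfl
        exact leftTranslation_one v
      exact (mfderiv_mul_left_leftTranslation p⁻¹ p v).trans (h1 _ (inv_mul_cancel p))
    exact Function.LeftInverse.injective h
  let A : E →ₗ[ℝ] E := (leftTranslation (E := E) p).toLinearMap
  exact ⟨hinj, (LinearMap.injective_iff_surjective (f := A)).1 hinj⟩

variable (Γ) in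
/-- The map `LeftQuotient.frame Γ p` as a continuous linear map. -/
def LeftQuotient.frameCLM (p : G) :
    GroupLieAlgebra 𝓘(ℝ, E) G →L[ℝ] TangentSpace 𝓘(ℝ, E) (LeftQuotient.proj Γ p) :=
  (mfderiv 𝓘(ℝ, E) 𝓘(ℝ, E) (LeftQuotient.proj Γ) p).comp (leftTranslation p)

theorem LeftQuotient.IsDistinguished.bijective_frameCLM [FiniteDimensional ℝ E] {p : G}
    (hp : LeftQuotient.IsDistinguished Γ p) :
    Function.Bijective (LeftQuotient.frameCLM (E := E) Γ p) :=
  hp.bijective_mfderiv_proj.comp (bijective_leftTranslation p)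

/-- A form on `Γ \ G` is induced by an alternating form `α₀` on the Lie algebra if its values on
the images of the left-invariant vector fields are the constants given by `α₀`. -/
def DiffForm.IsInducedBy {k : ℕ} (α : DiffForm E (LeftQuotient Γ) k)
    (α₀ : GroupLieAlgebra 𝓘(ℝ, E) G [⋀^Fin k]→L[ℝ] ℝ) : Prop :=
  ∀ p : G, (α (LeftQuotient.proj Γ p)).compContinuousLinearMap (LeftQuotient.frameCLM Γ p) = α₀

theorem DiffForm.IsInducedBy.isLeftInvariant_pullbackProj [FiniteDimensional ℝ E] {k : ℕ}
    {α : DiffForm E (LeftQuotient Γ) k} {α₀ : GroupLieAlgebra 𝓘(ℝ, E) G [⋀^Fin k]→L[ℝ] ℝ}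
    (hα : α.IsInducedBy α₀) : α.pullbackProj.IsLeftInvariant := by
  intro g p
  ext w
  choose v hv using fun i => (bijective_leftTranslation (E := E) p).2 (w i)
  obtain rfl : (fun i => leftTranslation p (v i)) = w := funext hv
  have h1 := DFunLike.congr_fun (hα (g * p)) v
  have h2 := DFunLike.congr_fun (hα p) v
  refine Eq.trans ?_ (h1.trans h2.symm)
  refine congrArg (α.pullbackProj (g * p)) (funext fun i => ?_)
  exact mfderiv_mul_left_leftTranslation g p (v i)

/-- The exterior derivative of a left-invariant form takes constant values on the images of the
left-invariant vector fields, at the distinguished points. -/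
theorem DiffForm.IsInducedBy.extD_comp_frameCLM [FiniteDimensional ℝ E] {k : ℕ}
    {α : DiffForm E (LeftQuotient Γ) k} {α₀ : GroupLieAlgebra 𝓘(ℝ, E) G [⋀^Fin k]→L[ℝ] ℝ}
    (hα : α.IsInducedBy α₀) {p : G} (hp : LeftQuotient.IsDistinguished Γ p) :
    (α.extD (LeftQuotient.proj Γ p)).compContinuousLinearMap (LeftQuotient.frameCLM Γ p) =
      α.pullbackProj.extD (1 : G) := by
  have h := hα.isLeftInvariant_pullbackProj.extD p 1
  rw [← h]
  ext v
  refine (DFunLike.congr_fun (hp.extD_pullbackProj α) fun i => leftTranslation p (v i)).trans ?_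
  exact (DiffForm.apply_congr α.pullbackProj.extD (mul_one p) _).symm

theorem DiffForm.IsInducedBy.wedgePow {η : DiffForm E (LeftQuotient Γ) 2}
    {η₀ : GroupLieAlgebra 𝓘(ℝ, E) G [⋀^Fin 2]→L[ℝ] ℝ} (hη : η.IsInducedBy η₀) (m : ℕ) :
    DiffForm.IsInducedBy (fun x => _root_.wedgePow (η x) m) (_root_.wedgePow η₀ m) := by
  intro p
  rw [wedgePow_compContinuousLinearMap, hη p]

theorem HermitianMetric.exists_isInducedBy_fundamentalForm
    {J : AlmostComplexStructure E (LeftQuotient Γ)} (hJ : J.IsLeftInvariantComplex)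
    (g : HermitianMetric J) (hg : g.IsLeftInvariant) :
    ∃ η₀, g.fundamentalForm.IsInducedBy η₀ := by
  obtain ⟨J₀, -, hJ₀⟩ := hJ
  obtain ⟨g₀, hg₀⟩ := hg
  have h (p : G) (v : Fin 2 → GroupLieAlgebra 𝓘(ℝ, E) G) :
      (g.fundamentalForm (LeftQuotient.proj Γ p)).compContinuousLinearMap
        (LeftQuotient.frameCLM Γ p) v = g₀ (J₀ (v 0)) (v 1) := by
    rw [← hg₀ p, ← hJ₀]
    rfl
  refine ⟨_, fun p => ContinuousAlternatingMap.ext fun v => (h p v).trans (h 1 v).symm⟩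

end Projection

section LeeForm

variable {E : Type*} [NormedAddCommGroup E] [NormedSpace ℝ E] [FiniteDimensional ℝ E]

/-- Injectivity of `α ↦ α ∧ ω ^ (n - 1)` on the cotangent spaces of a Hermitian manifold of complex
dimension `n`. -/
theorem HermitianMetric.eq_of_wedge_wedgePow_eq {M : Type*} [TopologicalSpace M]
    [ChartedSpace E M] [IsManifold 𝓘(ℝ, E) ∞ M] {J : AlmostComplexStructure E M}
    {n : ℕ} (hn : Module.finrank ℝ E = 2 * n) (g : HermitianMetric J) (x : M)
    (α β : TangentSpace 𝓘(ℝ, E) x [⋀^Fin 1]→L[ℝ] ℝ)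
    (h : wedge α (wedgePow (g.fundamentalForm x) (n - 1)) =
      wedge β (wedgePow (g.fundamentalForm x) (n - 1))) : α = β := by
  cases n with
  | zero =>
    have : Subsingleton E := Module.finrank_zero_iff.1 hn
    ext v
    have h1 (γ : E [⋀^Fin 1]→L[ℝ] ℝ) (w : Fin 1 → E) : γ w = 0 :=
      γ.map_coord_zero 0 (Subsingleton.elim _ _)
    exact (h1 α v).trans (h1 β v).symm
  | succ m =>
    have : FiniteDimensional ℝ (TangentSpace 𝓘(ℝ, E) x) := inferInstanceAs (FiniteDimensional ℝ E)
    have hn' : Module.finrank ℝ (TangentSpace 𝓘(ℝ, E) x) = 2 * (m + 1) := hn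
    refine sub_eq_zero.1 (eq_zero_of_wedge_wedgePow_eq_zero
      (V := TangentSpace 𝓘(ℝ, E) x) (m := m) hn' (g.inner x) (J.J x)
      (g.symm x) (g.pos x) (J.sq x) (g.hermitian x) (g.fundamentalForm x) (fun v => rfl) _ ?_)
    rw [wedge_sub_left, sub_eq_zero]
    exact h

omit [FiniteDimensional ℝ E] in
theorem HermitianMetric.IsLeeForm.extD_eq {M : Type*} [TopologicalSpace M]
    [ChartedSpace E M] [IsManifold 𝓘(ℝ, E) ∞ M] {J : AlmostComplexStructure E M}
    {n : ℕ} {g : HermitianMetric J} {θ : DiffForm E M 1} (hθ : g.IsLeeForm n θ) (x : M)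
    (v : Fin (1 + 2 * (n - 1)) → TangentSpace 𝓘(ℝ, E) x) :
    wedge (θ x) (wedgePow (g.fundamentalForm x) (n - 1)) v =
      DiffForm.extD (fun y => wedgePow (g.fundamentalForm y) (n - 1)) x
        (v ∘ Fin.cast (Nat.add_comm (2 * (n - 1)) 1)) :=
  (hθ.2 x (v ∘ Fin.cast (Nat.add_comm (2 * (n - 1)) 1))).symm

variable {G : Type*} [Group G] [TopologicalSpace G] [ChartedSpace E G] [LieGroup 𝓘(ℝ, E) ∞ G]
  {Γ : Subgroup G} [DiscreteTopology Γ] {J : AlmostComplexStructure E (LeftQuotient Γ)}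

/-- The Lee form of a left-invariant metric is left-invariant, at the distinguished points. -/
theorem HermitianMetric.IsLeeForm.comp_frameCLM_eq {n : ℕ} (hn : Module.finrank ℝ E = 2 * n)
    (hJ : J.IsLeftInvariantComplex) {g : HermitianMetric J} (hg : g.IsLeftInvariant)
    {θ : DiffForm E (LeftQuotient Γ) 1} (hθ : g.IsLeeForm n θ) {p q : G}
    (hp : LeftQuotient.IsDistinguished Γ p) (hq : LeftQuotient.IsDistinguished Γ q) :
    (θ (LeftQuotient.proj Γ p)).compContinuousLinearMap (LeftQuotient.frameCLM Γ p) =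
      (θ (LeftQuotient.proj Γ q)).compContinuousLinearMap (LeftQuotient.frameCLM Γ q) := by
  obtain ⟨η₀, hη₀⟩ := g.exists_isInducedBy_fundamentalForm hJ hg
  have hpow := hη₀.wedgePow (n - 1)
  have hwedge {r : G} (hr : LeftQuotient.IsDistinguished Γ r)
      (v : Fin (1 + 2 * (n - 1)) → GroupLieAlgebra 𝓘(ℝ, E) G) :
      wedge ((θ (LeftQuotient.proj Γ r)).compContinuousLinearMap (LeftQuotient.frameCLM Γ r))
        (wedgePow η₀ (n - 1)) v =
      (DiffForm.pullbackProj fun y => wedgePow (g.fundamentalForm y) (n - 1)).extD (1 : G)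
        (v ∘ Fin.cast (Nat.add_comm (2 * (n - 1)) 1)) := by
    rw [← hpow r, ← wedge_compContinuousLinearMap, ← hpow.extD_comp_frameCLM hr]
    exact hθ.extD_eq (LeftQuotient.proj Γ r) _
  have : FiniteDimensional ℝ (GroupLieAlgebra 𝓘(ℝ, E) G) :=
    inferInstanceAs (FiniteDimensional ℝ E)
  have : T2Space (GroupLieAlgebra 𝓘(ℝ, E) G) := inferInstanceAs (T2Space E)
  have : T2Space (TangentSpace 𝓘(ℝ, E) (LeftQuotient.proj Γ p)) := inferInstanceAs (T2Space E)
  -- transport `θ` from `π(q)` to `π(p)` through the invariant frame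
  let F : GroupLieAlgebra 𝓘(ℝ, E) G ≃L[ℝ] TangentSpace 𝓘(ℝ, E) (LeftQuotient.proj Γ p) :=
    (LinearEquiv.ofBijective (LeftQuotient.frameCLM (E := E) Γ p).toLinearMap
      hp.bijective_frameCLM).toContinuousLinearEquiv
  have hF (v : GroupLieAlgebra 𝓘(ℝ, E) G) : F.symm (LeftQuotient.frameCLM Γ p v) = v :=
    F.symm_apply_apply v
  let θ' : TangentSpace 𝓘(ℝ, E) (LeftQuotient.proj Γ p) [⋀^Fin 1]→L[ℝ] ℝ :=
    ((θ (LeftQuotient.proj Γ q)).compContinuousLinearMap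
      (LeftQuotient.frameCLM Γ q)).compContinuousLinearMap F.symm.toContinuousLinearMap
  have hθ' : θ'.compContinuousLinearMap (LeftQuotient.frameCLM Γ p) =
      (θ (LeftQuotient.proj Γ q)).compContinuousLinearMap (LeftQuotient.frameCLM Γ q) := by
    ext v
    refine congrArg ((θ (LeftQuotient.proj Γ q)).compContinuousLinearMap
      (LeftQuotient.frameCLM Γ q)) (funext fun i => hF (v i))
  rw [← hθ']
  congr 1
  apply g.eq_of_wedge_wedgePow_eq hn
  ext w
  choose v hv using fun i => hp.bijective_frameCLM.2 (w i)
  obtain rfl : (fun i => LeftQuotient.frameCLM Γ p (v i)) = w := funext hv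
  have h1 := hwedge hp v
  have h2 := hwedge hq v
  rw [← hθ', ← hpow p, ← wedge_compContinuousLinearMap] at h2
  rw [← hpow p, ← wedge_compContinuousLinearMap] at h1
  exact h1.trans h2.symm

end LeeForm

/-! ### Conformal metrics and exact differences of Lee forms -/

section Compact

variable {E : Type*} [NormedAddCommGroup E] [NormedSpace ℝ E]

/-- The differential of a smooth function on a nonempty compact manifold vanishes somewhere. -/
theorem exists_mfderiv_eq_zero {M : Type*} [TopologicalSpace M] [ChartedSpace E M] [CompactSpace M]
    [Nonempty M] {f : M → ℝ} (hf : ContMDiff 𝓘(ℝ, E) 𝓘(ℝ, ℝ) ∞ f) :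
    ∃ x : M, mfderiv 𝓘(ℝ, E) 𝓘(ℝ, ℝ) f x = 0 := by
  obtain ⟨x, -, hx⟩ := isCompact_univ.exists_isMaxOn Set.univ_nonempty hf.continuous.continuousOn
  refine ⟨x, ?_⟩
  have hmax : IsLocalMax (f ∘ (extChartAt 𝓘(ℝ, E) x).symm) (extChartAt 𝓘(ℝ, E) x x) := by
    refine Filter.Eventually.of_forall fun y => ?_
    simp only [Function.comp_apply, extChartAt_to_inv]
    exact hx (Set.mem_univ _)
  rw [((hf x).mdifferentiableAt (by simp)).mfderiv, modelWithCornersSelf_coe, Set.range_id,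
    fderivWithin_univ]
  exact hmax.fderiv_eq_zero

end Compact

theorem HermitianMetric.fundamentalForm_eq_smul {E : Type*} [NormedAddCommGroup E]
    [NormedSpace ℝ E] {M : Type*} [TopologicalSpace M] [ChartedSpace E M]
    [IsManifold 𝓘(ℝ, E) ∞ M] {J : AlmostComplexStructure E M} {g₁ g₂ : HermitianMetric J} {c : ℝ}
    (h : ∀ x v w, g₂.inner x v w = c * g₁.inner x v w) (x : M) :
    g₂.fundamentalForm x = c • g₁.fundamentalForm x :=
  ContinuousAlternatingMap.ext fun v => h x (J.J x (v 0)) (v 1)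

theorem DiffForm.extD_smul {E : Type*} [NormedAddCommGroup E] [NormedSpace ℝ E] {M : Type*}
    [TopologicalSpace M] [ChartedSpace E M] {k : ℕ} (c : ℝ) (α : DiffForm E M k) :
    DiffForm.extD (fun x => c • α x) = fun x => c • α.extD x := by
  ext x v
  have h : DiffForm.inChart (fun x => c • α x) x = c • α.inChart x := rfl
  unfold DiffForm.extD
  rw [h, extDeriv_smul]
  rfl

/-- Homothetic Hermitian metrics have the same Lee form. -/
theorem HermitianMetric.IsLeeForm.eq_of_homothetic {E : Type*} [NormedAddCommGroup E]
    [NormedSpace ℝ E] [FiniteDimensional ℝ E] {M : Type*} [TopologicalSpace M] [ChartedSpace E M]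
    [IsManifold 𝓘(ℝ, E) ∞ M] {J : AlmostComplexStructure E M} {n : ℕ}
    (hn : Module.finrank ℝ E = 2 * n) {g₁ g₂ : HermitianMetric J} {c : ℝ} (hc : c ≠ 0)
    (h : ∀ x v w, g₂.inner x v w = c * g₁.inner x v w) {θ₁ θ₂ : DiffForm E M 1}
    (hθ₁ : g₁.IsLeeForm n θ₁) (hθ₂ : g₂.IsLeeForm n θ₂) : θ₁ = θ₂ := by
  funext x
  apply g₁.eq_of_wedge_wedgePow_eq hn
  have hpow (y : M) : wedgePow (g₂.fundamentalForm y) (n - 1) =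
      c ^ (n - 1) • wedgePow (g₁.fundamentalForm y) (n - 1) := by
    rw [HermitianMetric.fundamentalForm_eq_smul h, wedgePow_smul]
  ext v
  apply mul_left_cancel₀ (pow_ne_zero (n - 1) hc)
  have h2 := hθ₂.extD_eq x v
  simp only [hpow] at h2
  rw [DiffForm.extD_smul] at h2
  have h3 := wedge_smul_smul 1 (c ^ (n - 1)) (θ₂ x) (wedgePow (g₁.fundamentalForm x) (n - 1))
  rw [one_smul, one_mul] at h3
  rw [h3] at h2
  rw [hθ₁.extD_eq x v]
  exact h2.symm

end

theorem proposition4p5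
    {E : Type*} [NormedAddCommGroup E] [NormedSpace ℝ E] [FiniteDimensional ℝ E]
    (n : ℕ) (hn : Module.finrank ℝ E = 2 * n)
    {G : Type*} [Group G] [TopologicalSpace G] [ChartedSpace E G] [LieGroup 𝓘(ℝ, E) ∞ G]
    [SimplyConnectedSpace G] [Group.IsNilpotent G]
    (Γ : Subgroup G) [DiscreteTopology Γ] [CompactSpace (LeftQuotient Γ)]
    (J : AlmostComplexStructure E (LeftQuotient Γ)) (hJ : J.IsLeftInvariantComplex)
    (g₁ g₂ : HermitianMetric J) (hg₁ : g₁.IsLeftInvariant) (hg₂ : g₂.IsLeftInvariant)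
    (hlcb₁ : g₁.IsLCB n) (hlcb₂ : g₂.IsLCB n)
    (θ₁ θ₂ : DiffForm E (LeftQuotient Γ) 1)
    (hθ₁ : g₁.IsLeeForm n θ₁) (hθ₂ : g₂.IsLeeForm n θ₂) (hne : θ₁ ≠ θ₂) :
    ¬ g₁.IsConformal g₂ ∧ ¬ DiffForm.IsExact (θ₁ - θ₂) := by
  constructor
  · rintro ⟨f, -, hf⟩
    refine hne ?_
    rcases subsingleton_or_nontrivial E with hE | hE
    · -- in dimension zero there is no nonzero `1`-form
      ext x v
      have h (α : DiffForm E (LeftQuotient Γ) 1) : α x v = 0 :=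
        (α x).map_coord_zero 0 (Subsingleton.elim (α := E) _ _)
      rw [h, h]
    · have : Nontrivial (GroupLieAlgebra 𝓘(ℝ, E) G) := hE
      obtain ⟨v, hv⟩ := exists_ne (0 : GroupLieAlgebra 𝓘(ℝ, E) G)
      obtain ⟨a₁, ha₁⟩ := hg₁
      obtain ⟨a₂, ha₂⟩ := hg₂
      have hconst (x : LeftQuotient Γ) : 0 < a₁ v v ∧ Real.exp (f x) = a₂ v v / a₁ v v := by
        obtain ⟨p, hp, rfl⟩ := LeftQuotient.exists_isDistinguished Γ x
        have h0 : LeftQuotient.frameCLM (E := E) Γ p v ≠ 0 := fun h =>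
          hv (hp.bijective_frameCLM.1 (h.trans (map_zero _).symm))
        have h1 : 0 < a₁ v v := (ha₁ p v v) ▸ g₁.pos _ _ h0
        refine ⟨h1, (eq_div_iff h1.ne').2 ?_⟩
        rw [← ha₁ p, ← ha₂ p, hf]
      have hc : 0 < a₂ v v / a₁ v v := (hconst (LeftQuotient.proj Γ 1)).2 ▸ Real.exp_pos _
      refine HermitianMetric.IsLeeForm.eq_of_homothetic hn hc.ne' (fun x u w => ?_) hθ₁ hθ₂
      rw [hf, (hconst x).2]
  · rintro ⟨f, hf, hdf⟩
    refine hne ?_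
    have : Nonempty (LeftQuotient Γ) := ⟨LeftQuotient.proj Γ 1⟩
    obtain ⟨x₀, hx₀⟩ := exists_mfderiv_eq_zero hf
    obtain ⟨q, hq, rfl⟩ := LeftQuotient.exists_isDistinguished Γ x₀
    have hθq : θ₁ (LeftQuotient.proj Γ q) = θ₂ (LeftQuotient.proj Γ q) := by
      ext v
      have h := hdf _ (v 0)
      rw [hx₀] at h
      have hv : ![v 0] = v := by
        ext i
        fin_cases i
        rfl
      rw [hv] at h
      exact sub_eq_zero.1 h
    funext x
    obtain ⟨p, hp, rfl⟩ := LeftQuotient.exists_isDistinguished Γ x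
    have h := (hθ₁.comp_frameCLM_eq hn hJ hg₁ hp hq).trans
      ((congrArg (fun α => α.compContinuousLinearMap (LeftQuotient.frameCLM Γ q)) hθq).trans
        (hθ₂.comp_frameCLM_eq hn hJ hg₂ hp hq).symm)
    ext w
    choose v hv using fun i => hp.bijective_frameCLM.2 (w i)
    obtain rfl : (fun i => LeftQuotient.frameCLM Γ p (v i)) = w := funext hv
    exact DFunLike.congr_fun h v
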